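/- Let $K$ be a field, let $S=K[x_1,\dots,x_n]$ be the standard graded polynomial ring, and let $I\subset S$ be a squarefree monomial ideal generated in degree $d$. Let $\mu(I)$ be the minimal number of generators of $I$, and assume that $n\ge 2d$ and $$\mu(I)\ \ge\ \binom{n}{d}-2d+1.$$ Then, for all $0\le\ell\le d$, the ideal $\partial^\ell(I)$ is vertex splittable and $\mathrm{reg}\,\partial^\ell(I)=d-\ell$. Here $\mathcal G(J)$ denotes the minimal monomial generating set of a monomial ideal $J$; the gradient ideal $\partial(J)$ is the ideal generated by all the partial derivatives of the elements of $\mathcal G(J)$, and $\partial^0(I)=I$, $\partial^{\ell}(I)=\partial(\partial^{\ell-1}(I))$ for $\ell\ge1$. The Castelnuovo-Mumford regularity is $\mathrm{reg}\,J=\max\{j-i:\ \mathrm{Tor}^S_i(K,J)_j\ne0\}$. A monomial ideal is vertex splittable if it is obtained by the following recursive procedure: (i) $(0)$, $S$ and $(u)$, for $u$ a monomial, are vertex splittable; (ii) if there are a variable $x_i$ and vertex splittable ideals $I_1\subset S$ and $I_2\subset K[x_1,\dots,x_{i-1},x_{i+1},\dots,x_n]$ such that $J=x_iI_1+I_2S$,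 $I_2\subseteq I_1$ and $\mathcal G(J)$ is the disjoint union of $\mathcal G(x_iI_1)$ and $\mathcal G(I_2)$, then $J$ is vertex splittable. -/

import Mathlib

namespace MonomialIdeals

open MvPolynomial

variable {σ K : Type*} [Field K]

/-- The minimal monomial generating set `G(I)`: the exponent vectors of the monomials of `I`
that are minimal with respect to divisibility. -/
def minimalGenerators (I : Ideal (MvPolynomial σ K)) : Set (σ →₀ ℕ) :=
  {u | Minimal (fun v => monomial v (1 : K) ∈ I) u}

/-- `I` is a squarefree monomial ideal: it is generated by squarefree monomials. -/
def IsSquarefreeMonomialIdeal (I : Ideal (MvPolynomial σ K)) : Prop :=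
  ∃ A : Set (σ →₀ ℕ), (∀ u ∈ A, ∀ i, u i ≤ 1) ∧
    I = Ideal.span ((fun u => monomial u (1 : K)) '' A)

/-- A monomial ideal is generated in degree `d`
if all its minimal monomial generators have degree `d`. -/
def IsGeneratedInDegree (I : Ideal (MvPolynomial σ K)) (d : ℕ) : Prop :=
  ∀ u ∈ minimalGenerators I, u.degree = d

/-- The gradient ideal of a monomial ideal: the ideal generated by all the partial derivatives
of the minimal monomial generators. -/
noncomputable def gradientIdeal (I : Ideal (MvPolynomial σ K)) : Ideal (MvPolynomial σ K) :=
  Ideal.span {f | ∃ u ∈ minimalGenerators I, ∃ i : σ, f = pderiv i (monomial u (1 : K))}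

/-- `VertexSplittableOn V I`: the ideal `I` is the extension to `K[x_j : j ∈ σ]` of a vertex
splittable monomial ideal of the polynomial ring `K[x_j : j ∈ V]`.  (Extension of ideals from
`K[x_j : j ∈ V]` is injective, and preserves and reflects inclusions, sums, products and minimal
monomial generators.) -/
inductive VertexSplittableOn [DecidableEq σ] :
    Finset σ → Ideal (MvPolynomial σ K) → Prop
  | principal (V : Finset σ) (u : σ →₀ ℕ) (hu : u.support ⊆ V) :
      VertexSplittableOn V (Ideal.span {monomial u (1 : K)})
  | zero (V : Finset σ) : VertexSplittableOn V ⊥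
  | one (V : Finset σ) : VertexSplittableOn V ⊤
  | split (V : Finset σ) (i : σ) (hi : i ∈ V) (I I₁ I₂ : Ideal (MvPolynomial σ K))
      (h₁ : VertexSplittableOn V I₁) (h₂ : VertexSplittableOn (V.erase i) I₂)
      (hI : I = Ideal.span {(X i : MvPolynomial σ K)} * I₁ ⊔ I₂)
      (hle : I₂ ≤ I₁)
      (hunion : minimalGenerators I =
        minimalGenerators (Ideal.span {(X i : MvPolynomial σ K)} * I₁) ∪ minimalGenerators I₂)
      (hdisj : Disjoint
        (minimalGenerators (Ideal.span {(X i : MvPolynomial σ K)} * I₁)) (minimalGenerators I₂)) :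
      VertexSplittableOn V I

/-- Vertex splittable ideals of the polynomial ring in all the variables. -/
def IsVertexSplittable [Fintype σ] [DecidableEq σ] (I : Ideal (MvPolynomial σ K)) : Prop :=
  VertexSplittableOn Finset.univ I

/-- A graded free resolution `⋯ → F₁ → F₀ → I → 0` of an ideal `I` over `S = K[x_j : j ∈ σ]`.
Here `F i` is the free `S`-module on `basis i`, where the basis element `b` is placed in degree
`deg i b`, and all the maps are homogeneous of degree `0`. -/
structure GradedFreeResolution (I : Ideal (MvPolynomial σ K)) where
  /-- the index set of the homogeneous basis of `F i` -/
  basis : ℕ → Type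
  /-- the degrees of the basis elements -/
  deg : ∀ i, basis i → ℕ
  /-- the augmentation `F 0 → I ⊆ S` -/
  aug : (basis 0 →₀ MvPolynomial σ K) →ₗ[MvPolynomial σ K] MvPolynomial σ K
  /-- the differentials `F (i + 1) → F i` -/
  d : ∀ i, (basis (i + 1) →₀ MvPolynomial σ K) →ₗ[MvPolynomial σ K]
    (basis i →₀ MvPolynomial σ K)
  aug_homogeneous : ∀ b, (aug (Finsupp.single b 1)).IsHomogeneous (deg 0 b)
  /-- each coefficient of `d b` at `b'` is zero or homogeneous of degree `deg b - deg b'` -/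
  d_homogeneous : ∀ i b b', ∀ m ∈ (d i (Finsupp.single b 1) b').support,
    m.degree + deg i b' = deg (i + 1) b
  range_aug : LinearMap.range aug = I
  exact_zero : LinearMap.range (d 0) = LinearMap.ker aug
  exact_succ : ∀ i, LinearMap.range (d (i + 1)) = LinearMap.ker (d i)

namespace GradedFreeResolution

variable {I : Ideal (MvPolynomial σ K)} (F : GradedFreeResolution I)

/-- The differential of the complex `K ⊗_S F`, where `K = S / (x_j : j ∈ σ)`: the module
`K ⊗_S F i` is the `K`-vector space on `basis i`, and the matrix of the differential consists of
the constant coefficients of the matrix of `d i`. -/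
noncomputable def dbar (i : ℕ) : (F.basis (i + 1) →₀ K) →ₗ[K] (F.basis i →₀ K) :=
  Finsupp.linearCombination K fun b =>
    (F.d i (Finsupp.single b 1)).mapRange constantCoeff (map_zero _)

/-- The cycles of the complex `K ⊗_S F`. -/
noncomputable def cycles : ∀ i, Submodule K (F.basis i →₀ K)
  | 0 => ⊤
  | i + 1 => LinearMap.ker (F.dbar i)

/-- The component of degree `j` of the graded vector space `K ⊗_S F i`. -/
noncomputable def degreePart (i j : ℕ) : Submodule K (F.basis i →₀ K) :=
  Finsupp.supported K K {b | F.deg i b = j}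

/-- The boundaries of degree `j` in `K ⊗_S F i`. -/
noncomputable def boundaries (i j : ℕ) : Submodule K (F.basis i →₀ K) :=
  (F.degreePart (i + 1) j).map (F.dbar i)

/-- `Tor_i^S(K, I)_j ≠ 0`: the degree `j` component of the `i`-th homology of the complex
`K ⊗_S F` is nonzero, that is, some cycle of degree `j` is not a boundary. As `Tor` is independent
of the resolution, so is this property. -/
def TorNeZero (i j : ℕ) : Prop :=
  ∃ z ∈ F.cycles i ⊓ F.degreePart i j, z ∉ F.boundaries i j

end GradedFreeResolution

/-- `reg I = r`, where `reg I = max {j - i : Tor_i^S(K, I)_j ≠ 0}` is the Castelnuovo-Mumford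
regularity of `I`, with `Tor` computed from a graded free resolution of `I`. The relation
includes that the maximum exists; the zero ideal has no regularity in this sense. -/
def HasRegularity (I : Ideal (MvPolynomial σ K)) (r : ℤ) : Prop :=
  ∃ F : GradedFreeResolution I,
    IsGreatest {m : ℤ | ∃ i j : ℕ, F.TorNeZero i j ∧ m = (j : ℤ) - (i : ℤ)} r

end MonomialIdeals

/-! A squarefree monomial ideal generated in degree `d` is the ideal of a `d`-uniform family `A`,
and the bound on the number of generators says that fewer than `2d` of the `d`-subsets are missing
from `A`. Let `C` be the family of missing sets. Everything reduces to combinatorics of `C`.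

Splitting off the variable `x_i` divides `A` into its link and its deletion at `i`. The inclusion
`I₂ ⊆ I₁` says that each `b ∈ A` avoiding `i` can exchange some element for `i` inside `A`. This
fails exactly when, for some such `b`, all facets of `b ∪ {i}` through `i` lie in `C`. Double
counting yields a vertex without such an obstruction and with at most `2d - 3` sets of `C` through
it (`exists_splitting_vertex`). Link and deletion then satisfy the same kind of bound, and induction
on the vertex set applies (`splittableFamily_of_card`).

For uniform families the gradient is the shadow, and the local LYM inequality preserves the bound
(`card_compl_shadow_lt`). Finally, `xI₁ ∩ I₂ = xI₂`, so the mapping cone of `I₂ ⊆ I₁` resolves `xI₁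
+ I₂` linearly (`HasLinearResolution.span_mul_sup`), which gives the regularity. -/

namespace MonomialIdeals

/-! ### Obstructions to splitting off a vertex -/

open Finset

variable {σ : Type*} [DecidableEq σ]

/-- The facets of the simplex `T` other than the one opposite to `w`. -/
def facetsExcept (T : Finset σ) (w : σ) : Finset (Finset σ) := (T.erase w).image T.erase

theorem card_facetsExcept {T : Finset σ} {w : σ} (hw : w ∈ T) :
    #(facetsExcept T w) + 1 = #T := by
  unfold facetsExcept
  rw [card_image_of_injOn, card_erase_add_one hw]
  exact (erase_injOn T).mono (by simp)

theorem card_filter_mem_facetsExcept {T : Finset σ} {w k : σ} (hk : k ∈ T) (hkw : k ≠ w)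
    (hw : w ∈ T) : #{c ∈ facetsExcept T w | k ∈ c} + 2 = #T := by
  have h : {c ∈ facetsExcept T w | k ∈ c} = (facetsExcept T w).erase (T.erase k) := by
    ext c
    simp only [facetsExcept, mem_filter, mem_image, mem_erase]
    constructor
    · rintro ⟨⟨j, hj, rfl⟩, hkc⟩
      exact ⟨fun h => by simp [h] at hkc, j, hj, rfl⟩
    · rintro ⟨h, j, hj, rfl⟩
      refine ⟨⟨j, hj, rfl⟩, mem_erase.2 ⟨?_, hk⟩⟩
      rintro rfl
      exact h rfl
  have hm : T.erase k ∈ facetsExcept T w :=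
    mem_image.2 ⟨k, mem_erase.2 ⟨hkw, hk⟩, rfl⟩
  have := card_facetsExcept hw
  have := card_erase_add_one hm
  rw [h]
  omega

/-- `T` witnesses that the vertex `i` cannot be split off from the complement of `C`. -/
structure IsObstruction (C : Finset (Finset σ)) (i : σ) (T : Finset σ) : Prop where
  mem : i ∈ T
  erase_notMem : T.erase i ∉ C
  facets_subset : facetsExcept T i ⊆ C

/-- A facet `T \ j` with `j ≠ i` contains `i`. Hence an obstruction on `d + 1` points needs at least
`d` sets of `C` through `i`, and vertices of smaller degree are unobstructed. -/
theorem IsObstruction.card_le {C : Finset (Finset σ)} {i : σ} {T : Finset σ}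
    (h : IsObstruction C i T) : #T ≤ #{c ∈ C | i ∈ c} + 1 := by
  rw [← card_facetsExcept h.mem]
  gcongr
  intro c hc
  refine mem_filter.2 ⟨h.facets_subset hc, ?_⟩
  obtain ⟨j, hj, rfl⟩ := mem_image.1 hc
  exact mem_erase.2 ⟨(ne_of_mem_erase hj).symm, h.mem⟩

/-- Two different obstructions to distinct vertices exhaust a small family, and a vertex of the
first one has small degree. -/
theorem IsObstruction.exists_card_filter_lt {C : Finset (Finset σ)} {d : ℕ} {w k : σ}
    {T T' : Finset σ} (h : IsObstruction C w T) (h' : IsObstruction C k T') (hne : T ≠ T')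
    (hT : #T = d + 1) (hT' : #T' = d + 1) (hC : #C < 2 * d) :
    ∃ p ∈ T, #{c ∈ C | p ∈ c} < d := by
  have hf := card_facetsExcept h.mem
  have hf' := card_facetsExcept h'.mem
  -- Distinct simplices of equal size share at most one facet, namely their intersection.
  have key : ∀ s ∈ facetsExcept T w ∩ facetsExcept T' k, s = T ∩ T' := by
    intro s hs
    obtain ⟨hs1, hs2⟩ := mem_inter.1 hs
    obtain ⟨j, hj, rfl⟩ := mem_image.1 hs1
    obtain ⟨j', hj', he⟩ := mem_image.1 hs2
    apply eq_of_subset_of_card_le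
    · exact subset_inter (erase_subset _ _) (he ▸ erase_subset _ _)
    · have : #(T ∩ T') < #T := by
        apply card_lt_card
        refine ssubset_of_subset_of_ne inter_subset_left fun hh => hne ?_
        exact eq_of_subset_of_card_le (inter_eq_left.1 hh) (by omega)
      have := card_erase_add_one (mem_of_mem_erase hj)
      omega
  have hsub : facetsExcept T w ∪ facetsExcept T' k ⊆ C :=
    union_subset h.facets_subset h'.facets_subset
  have hui := card_union_add_card_inter (facetsExcept T w) (facetsExcept T' k)
  have hle := card_le_card hsub
  obtain ⟨s, hs⟩ : (facetsExcept T w ∩ facetsExcept T' k).Nonempty := by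
    rw [← card_pos]; omega
  have hone : #(facetsExcept T w ∩ facetsExcept T' k) ≤ 1 :=
    card_le_one.2 fun a ha b hb => (key a ha).trans (key b hb).symm
  -- Two families of `d` facets with at most one in common have at least `2d - 1` members, which is
  -- all that `C` can have.
  have hCeq : facetsExcept T w ∪ facetsExcept T' k = C :=
    eq_of_subset_of_card_le hsub (by omega)
  obtain ⟨p, hp, rfl⟩ := mem_image.1 (mem_inter.1 hs).1
  have hpT := mem_of_mem_erase hp
  have hpT' : p ∉ T' := by
    intro hpT'
    have := key _ hs
    have h2 : p ∈ T ∩ T' := mem_inter.2 ⟨hpT, hpT'⟩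
    rw [← this] at h2
    simp at h2
  refine ⟨p, hpT, ?_⟩
  have h3 : {c ∈ C | p ∈ c} ⊆ {c ∈ facetsExcept T w | p ∈ c} := by
    intro c hc
    obtain ⟨hc, hpc⟩ := mem_filter.1 hc
    rw [← hCeq] at hc
    refine mem_filter.2 ⟨(mem_union.1 hc).resolve_right fun hc' => hpT' ?_, hpc⟩
    obtain ⟨j, -, rfl⟩ := mem_image.1 hc'
    exact mem_of_mem_erase hpc
  have := card_le_card h3
  have := card_filter_mem_facetsExcept hpT (ne_of_mem_erase hp) h.mem
  omega

theorem sum_card_filter_mem (C : Finset (Finset σ)) (W : Finset σ) :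
    ∑ v ∈ W, #{c ∈ C | v ∈ c} = ∑ c ∈ C, #(W ∩ c) := by
  have := sum_card_bipartiteAbove_eq_sum_card_bipartiteBelow (s := W) (t := C)
    (fun v c => v ∈ c)
  simpa [bipartiteAbove, bipartiteBelow, filter_mem_eq_inter] using this

/-- A vertex `w` of minimal degree in `C` works unless it has an obstruction `T`. In that case some
other vertex `k` of `T` works: an obstruction at `k` would produce a vertex of degree below `d`,
against the minimality of `w`. The bound `2d - 3` on the degree is what the link needs, its
uniformity being `d - 1`. -/
theorem exists_splitting_vertex {C : Finset (Finset σ)} {V : Finset σ} {d : ℕ} (hd : 2 ≤ d)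
    (hCV : C ⊆ V.powersetCard d) (hC : #C < 2 * d) (hV : d + 2 ≤ #V) :
    ∃ i ∈ V, #{c ∈ C | i ∈ c} + 3 ≤ 2 * d ∧
      ∀ T ⊆ V, #T = d + 1 → ¬ IsObstruction C i T := by
  have hVne : V.Nonempty := card_pos.1 (by omega)
  obtain ⟨w, hwV, hw⟩ := exists_min_image V (fun v => #{c ∈ C | v ∈ c}) hVne
  by_cases hlt : #{c ∈ C | w ∈ c} < d
  · refine ⟨w, hwV, by omega, fun T _ hT h => ?_⟩
    have := h.card_le
    omega
  have hge : ∀ v ∈ V, d ≤ #{c ∈ C | v ∈ c} := fun v hv => (not_lt.1 hlt).trans (hw v hv)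
  by_cases hobs : ∀ T ⊆ V, #T = d + 1 → ¬ IsObstruction C w T
  · refine ⟨w, hwV, ?_, hobs⟩
    by_contra hcon
    -- If the minimal degree is at least `2d - 2`, counting incidences gives `(d + 2)(2d - 2) ≤ (2d
    -- - 1)d`, which is false for `d ≥ 2`.
    have h1 : #V * (2 * d - 2) ≤ ∑ v ∈ V, #{c ∈ C | v ∈ c} := by
      rw [← smul_eq_mul]
      refine card_nsmul_le_sum _ _ _ fun v hv => ?_
      have := hw v hv
      omega
    have h2 : ∑ c ∈ C, #(V ∩ c) ≤ #C * d := by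
      rw [← smul_eq_mul]
      refine sum_le_card_nsmul _ _ _ fun c hc => ?_
      rw [← (mem_powersetCard.1 (hCV hc)).2]
      exact card_le_card inter_subset_right
    rw [sum_card_filter_mem] at h1
    obtain ⟨e, rfl⟩ := Nat.exists_eq_add_of_le hd
    have h3 : (2 + e + 2) * (2 * (2 + e) - 2) ≤ (2 * (2 + e) - 1) * (2 + e) :=
      (Nat.mul_le_mul_right _ hV).trans (h1.trans (h2.trans (Nat.mul_le_mul_right _ (by omega))))
    have e1 : 2 * (2 + e) - 2 = 2 * e + 2 := by omega
    have e2 : 2 * (2 + e) - 1 = 2 * e + 3 := by omega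
    rw [e1, e2] at h3
    nlinarith
  push Not at hobs
  obtain ⟨T, hTV, hT, hobs⟩ := hobs
  have hf := card_facetsExcept hobs.mem
  have hO := card_sdiff_add_card_eq_card hobs.facets_subset
  -- At most `d - 1` sets of `C` are not facets of `T` through `w`. Each meets the `d`-set `T \ w`
  -- in at most `d - 1` points because `T \ w ∉ C`, so not all `d` points can have degree `d - 1` in
  -- this remainder.
  obtain ⟨k, hk, hkO⟩ : ∃ k ∈ T.erase w, #{c ∈ C \ facetsExcept T w | k ∈ c} + 2 ≤ d := by
    by_contra! hcon
    have h1 : #(T.erase w) * (d - 1) ≤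
        ∑ v ∈ T.erase w, #{c ∈ C \ facetsExcept T w | v ∈ c} := by
      rw [← smul_eq_mul]
      refine card_nsmul_le_sum _ _ _ fun v hv => ?_
      have := hcon v hv
      omega
    have hTw := card_erase_add_one hobs.mem
    have h2 : ∑ c ∈ C \ facetsExcept T w, #(T.erase w ∩ c) ≤
        #(C \ facetsExcept T w) * (d - 1) := by
      rw [← smul_eq_mul]
      refine sum_le_card_nsmul _ _ _ fun c hc => ?_
      have hcC := (mem_sdiff.1 hc).1
      have hcd := (mem_powersetCard.1 (hCV hcC)).2
      have : #(T.erase w ∩ c) < #c := by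
        refine card_lt_card (ssubset_of_subset_of_ne inter_subset_right fun hh => ?_)
        have := eq_of_subset_of_card_le (inter_eq_right.1 hh) (by omega)
        exact hobs.erase_notMem (this ▸ hcC)
      omega
    rw [sum_card_filter_mem] at h1
    have h3 := Nat.le_of_mul_le_mul_right (h1.trans h2) (by omega)
    omega
  have hkT := mem_of_mem_erase hk
  have hkw := ne_of_mem_erase hk
  refine ⟨k, hTV hkT, ?_, fun T' hT'V hT' hobs' => ?_⟩
  -- The degree of `k` is at most `(d - 2) + (d - 1) = 2d - 3`, the second term counting the facets
  -- of `T` through both `w` and `k`.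
  · have h1 := card_filter_mem_facetsExcept hkT hkw hobs.mem
    have h2 : #{c ∈ C | k ∈ c} ≤
        #{c ∈ C \ facetsExcept T w | k ∈ c} + #{c ∈ facetsExcept T w | k ∈ c} := by
      refine le_trans (card_le_card ?_) (card_union_le _ _)
      rw [← filter_union, sdiff_union_of_subset hobs.facets_subset]
    omega
  · have hne : T ≠ T' := by
      rintro rfl
      exact hobs'.erase_notMem (hobs.facets_subset (mem_image.2 ⟨k, hk, rfl⟩))
    obtain ⟨p, hp, hplt⟩ := hobs.exists_card_filter_lt hobs' hne hT hT' hC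
    have := hge p (hTV hp)
    omega

/-! ### Splitting uniform families with few missing sets -/

/-- The `d`-uniform families of subsets of `V` obtained by repeatedly splitting off vertices. -/
inductive SplittableFamily : ℕ → Finset σ → Finset (Finset σ) → Prop
  | empty (d : ℕ) (V : Finset σ) : SplittableFamily d V ∅
  | singleton (V a : Finset σ) (ha : a ⊆ V) : SplittableFamily #a V {a}
  | split (d : ℕ) (V : Finset σ) (i : σ) (hi : i ∉ V) (A B : Finset (Finset σ))
      (hA : SplittableFamily d V A) (hB : SplittableFamily (d + 1) V B)
      (hAB : ∀ b ∈ B, ∃ a ∈ A, a ⊆ b) :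
      SplittableFamily (d + 1) (insert i V) (A.image (insert i) ∪ B)

theorem SplittableFamily.subset_powersetCard {d : ℕ} {V : Finset σ} {A : Finset (Finset σ)}
    (h : SplittableFamily d V A) : A ⊆ V.powersetCard d := by
  induction h with
  | empty d V => simp
  | singleton V a ha => simpa using ha
  | split d V i hi A B _ _ hAB hA hB =>
    intro a ha
    rw [mem_powersetCard]
    rcases mem_union.1 ha with ha | ha
    · obtain ⟨b, hb, rfl⟩ := mem_image.1 ha
      have := mem_powersetCard.1 (hA hb)
      exact ⟨insert_subset_insert _ this.1,
        by rw [card_insert_of_notMem fun h => hi (this.1 h), this.2]⟩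
    · have := mem_powersetCard.1 (hB ha)
      exact ⟨this.1.trans (subset_insert _ _), this.2⟩

theorem SplittableFamily.of_card_le_one {d : ℕ} {V : Finset σ} {A : Finset (Finset σ)}
    (hA : A ⊆ V.powersetCard d) (h : #A ≤ 1) : SplittableFamily d V A := by
  rcases A.eq_empty_or_nonempty with rfl | hne
  · exact .empty d V
  · obtain ⟨a, rfl⟩ := card_eq_one.1 (le_antisymm h (card_pos.2 hne))
    obtain ⟨h1, rfl⟩ := mem_powersetCard.1 (singleton_subset_iff.1 hA)
    exact .singleton V a h1

theorem memberSubfamily_subset_powersetCard {d : ℕ} {V : Finset σ} {A : Finset (Finset σ)}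
    (hA : A ⊆ V.powersetCard (d + 1)) (i : σ) :
    A.memberSubfamily i ⊆ (V.erase i).powersetCard d := by
  intro a ha
  obtain ⟨ha, hia⟩ := mem_memberSubfamily.1 ha
  obtain ⟨h1, h2⟩ := mem_powersetCard.1 (hA ha)
  rw [card_insert_of_notMem hia] at h2
  refine mem_powersetCard.2 ⟨?_, by omega⟩
  exact subset_erase.2 ⟨(subset_insert _ _).trans h1, hia⟩

theorem nonMemberSubfamily_subset_powersetCard {d : ℕ} {V : Finset σ} {A : Finset (Finset σ)}
    (hA : A ⊆ V.powersetCard d) (i : σ) :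
    A.nonMemberSubfamily i ⊆ (V.erase i).powersetCard d := by
  intro a ha
  obtain ⟨ha, hia⟩ := mem_nonMemberSubfamily.1 ha
  obtain ⟨h1, h2⟩ := mem_powersetCard.1 (hA ha)
  exact mem_powersetCard.2 ⟨subset_erase.2 ⟨h1, hia⟩, h2⟩

/-- The exchange hypothesis puts `b \ j` into the link of `i`, so every set of the deletion contains
a set of the link. -/
theorem SplittableFamily.of_subfamilies {d : ℕ} {V : Finset σ} {A : Finset (Finset σ)} {i : σ}
    (hi : i ∈ V)
    (h1 : SplittableFamily d (V.erase i) (A.memberSubfamily i))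
    (h2 : SplittableFamily (d + 1) (V.erase i) (A.nonMemberSubfamily i))
    (h : ∀ b ∈ A, i ∉ b → ∃ j ∈ b, insert i (b.erase j) ∈ A) : SplittableFamily (d + 1) V A := by
  have := SplittableFamily.split d (V.erase i) i (notMem_erase i V) _ _ h1 h2 ?_
  · rw [insert_erase hi] at this
    convert this
    ext a
    simp only [mem_union, mem_image, mem_memberSubfamily, mem_nonMemberSubfamily]
    constructor
    · intro ha
      by_cases hia : i ∈ a
      · exact Or.inl ⟨a.erase i, ⟨by rwa [insert_erase hia], notMem_erase i a⟩, insert_erase hia⟩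
      · exact Or.inr ⟨ha, hia⟩
    · rintro (⟨b, ⟨hb, -⟩, rfl⟩ | ⟨ha, -⟩) <;> assumption
  · intro b hb
    obtain ⟨hb, hib⟩ := mem_nonMemberSubfamily.1 hb
    obtain ⟨j, hj, hj'⟩ := h b hb hib
    exact ⟨b.erase j, mem_memberSubfamily.2 ⟨hj', fun hh => hib (mem_of_mem_erase hh)⟩,
      erase_subset _ _⟩

/-- The disjunction is chosen so that link and deletion inherit it: the first two alternatives
absorb the cases where `exists_splitting_vertex` is unavailable, and there exchange is automatic. -/
theorem splittableFamily_of_card {d : ℕ} {V : Finset σ} {A : Finset (Finset σ)}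
    (hA : A ⊆ V.powersetCard d)
    (h : d ≤ 1 ∨ #V ≤ d + 1 ∨ #(V.powersetCard d \ A) < 2 * d) : SplittableFamily d V A := by
  induction hm : #V generalizing d V A with
  | zero =>
    apply SplittableFamily.of_card_le_one hA
    refine (card_le_card hA).trans ?_
    rw [card_powersetCard, hm]
    cases d <;> simp
  | succ m ih =>
    by_cases hA1 : #A ≤ 1
    · exact SplittableFamily.of_card_le_one hA hA1
    obtain ⟨d, rfl⟩ : ∃ e, d = e + 1 := by
      refine Nat.exists_eq_succ_of_ne_zero ?_
      rintro rfl
      exact hA1 ((card_le_card hA).trans (by simp))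
    have hlt : d + 1 < #V := by
      by_contra hlt
      apply hA1
      refine (card_le_card hA).trans ?_
      rw [card_powersetCard]
      rcases (not_lt.1 hlt).lt_or_eq with hh | hh
      · rw [Nat.choose_eq_zero_of_lt hh]; simp
      · rw [hh, Nat.choose_self]
    by_cases hbig : 1 ≤ d ∧ d + 3 ≤ #V
    · have hC : #(V.powersetCard (d + 1) \ A) < 2 * (d + 1) := by omega
      obtain ⟨i, hiV, hi, hobs⟩ := exists_splitting_vertex (d := d + 1) (by omega)
        sdiff_subset hC (by omega)
      have hcard : #(V.erase i) = m := by rw [card_erase_of_mem hiV]; omega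
      refine SplittableFamily.of_subfamilies hiV
        (ih (memberSubfamily_subset_powersetCard hA i) (Or.inr (Or.inr ?_)) hcard)
        (ih (nonMemberSubfamily_subset_powersetCard hA i) (Or.inr (Or.inr ?_)) hcard) ?_
      · refine lt_of_le_of_lt ?_ (show #{c ∈ V.powersetCard (d + 1) \ A | i ∈ c} < 2 * d by omega)
        -- Adjoining `i` sends the sets missing from the link injectively to the missing sets
        -- through `i`.
        refine card_le_card_of_injOn (insert i) ?_ ?_
        · intro c hc
          simp only [coe_sdiff, Set.mem_sdiff, mem_coe, mem_powersetCard, mem_memberSubfamily,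
            subset_erase, not_and_not_right] at hc
          simp only [coe_filter, mem_sdiff, mem_powersetCard, Set.mem_ofPred_eq,
            mem_insert_self, and_true]
          refine ⟨⟨insert_subset hiV hc.1.1.1, ?_⟩, fun hh => hc.1.1.2 (hc.2 hh)⟩
          rw [card_insert_of_notMem hc.1.1.2, hc.1.2]
        · intro c hc c' hc' he
          simp only [coe_sdiff, Set.mem_sdiff, mem_coe, mem_powersetCard,
            subset_erase] at hc hc'
          rw [← erase_insert hc.1.1.2, ← erase_insert hc'.1.1.2, he]
      · refine lt_of_le_of_lt (card_le_card ?_) hC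
        intro c hc
        simp only [mem_sdiff, mem_powersetCard, mem_nonMemberSubfamily, subset_erase,
          not_and_not_right] at hc ⊢
        exact ⟨⟨hc.1.1.1, hc.1.2⟩, fun hh => hc.1.1.2 (hc.2 hh)⟩
      · intro b hb hib
        by_contra! hcon
        obtain ⟨hbV, hbd⟩ := mem_powersetCard.1 (hA hb)
        have hcard' : #(insert i b) = d + 2 := by rw [card_insert_of_notMem hib, hbd]
        -- If no exchange from `b` stays in `A`, then `b ∪ {i}` is an obstruction at `i`.
        refine hobs (insert i b) (insert_subset hiV hbV) hcard' ⟨mem_insert_self _ _, ?_, ?_⟩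
        · simp [erase_insert hib, hb]
        · intro c hc
          obtain ⟨j, hj, rfl⟩ := mem_image.1 hc
          rw [erase_insert hib] at hj
          have hji : j ≠ i := fun h => hib (h ▸ hj)
          rw [erase_insert_of_ne hji.symm]
          refine mem_sdiff.2 ⟨mem_powersetCard.2 ⟨insert_subset hiV
            ((erase_subset _ _).trans hbV), ?_⟩, hcon j hj⟩
          rw [card_insert_of_notMem fun h => hib (mem_of_mem_erase h), card_erase_add_one hj, hbd]
    · have hsmall : d = 0 ∨ #V = d + 2 := by omega
      have hexch : ∃ i ∈ V, ∀ b ∈ A, i ∉ b → ∃ j ∈ b, insert i (b.erase j) ∈ A := by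
        obtain ⟨a, ha, a', ha', hne⟩ := one_lt_card.1 (not_le.1 hA1)
        obtain ⟨haV, had⟩ := mem_powersetCard.1 (hA ha)
        obtain ⟨haV', had'⟩ := mem_powersetCard.1 (hA ha')
        obtain ⟨i, hia', hia⟩ : ∃ i ∈ a', i ∉ a := by
          by_contra! hcon
          exact hne (eq_of_subset_of_card_le hcon (by omega)).symm
        refine ⟨i, haV' hia', fun b hb hib => ?_⟩
        obtain ⟨hbV, hbd⟩ := mem_powersetCard.1 (hA hb)
        obtain ⟨j, hj, hja'⟩ : ∃ j ∈ b, j ∉ a' := by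
          by_contra! hcon
          exact hib (by rwa [eq_of_subset_of_card_le hcon (by omega)])
        refine ⟨j, hj, ?_⟩
        -- The exchanged set is `a'` itself: in uniformity one both are `{i}`, and when `V` has one
        -- point more than the uniformity both are `V \ j`.
        convert ha'
        symm
        rcases hsmall with rfl | hV2
        · obtain ⟨x, rfl⟩ := card_eq_one.1 had'
          obtain ⟨y, rfl⟩ := card_eq_one.1 hbd
          simp_all
        · have hib' : i ∉ b.erase j := fun h => hib (mem_of_mem_erase h)
          have h1 : insert i (b.erase j) = V.erase j := by
            apply eq_of_subset_of_card_le
            · refine insert_subset (mem_erase.2 ⟨fun h => hib (h ▸ hj), haV' hia'⟩) ?_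
              exact erase_subset_erase _ hbV
            · rw [card_insert_of_notMem hib', card_erase_add_one hj,
                card_erase_of_mem (hbV hj)]
              omega
          rw [h1]
          apply eq_of_subset_of_card_le
          · exact subset_erase.2 ⟨haV', hja'⟩
          · rw [card_erase_of_mem (hbV hj)]
            omega
      obtain ⟨i, hiV, hi⟩ := hexch
      have hcard : #(V.erase i) = m := by rw [card_erase_of_mem hiV]; omega
      exact SplittableFamily.of_subfamilies hiV
        (ih (memberSubfamily_subset_powersetCard hA i) (by omega) hcard)
        (ih (nonMemberSubfamily_subset_powersetCard hA i) (by omega) hcard) hi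

/-! ### Missing sets of the shadow -/

/-- With `q = n - d`, local LYM passes to complements as `#(missing from shadow) * q ≤ #(missing
from A) * (d + 1)`. If `2d` sets were missing from the shadow, then `2d(d + 2) ≤ 2dq ≤ (2d + 1)(d +
1)`, forcing `d ≤ 1`. -/
theorem card_compl_shadow_lt [Fintype σ] {d : ℕ} {A : Finset (Finset σ)}
    (hA : A ⊆ (univ : Finset σ).powersetCard (d + 1)) (hd : 2 ≤ d)
    (hn : 2 * (d + 1) ≤ Fintype.card σ)
    (h : #((univ : Finset σ).powersetCard (d + 1) \ A) < 2 * (d + 1)) :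
    #((univ : Finset σ).powersetCard d \ A.shadow) < 2 * d := by
  have hsized : (A : Set (Finset σ)).Sized (d + 1) := fun a ha => (mem_powersetCard.1 (hA ha)).2
  have hsub : A.shadow ⊆ (univ : Finset σ).powersetCard d := by
    intro a ha
    exact mem_powersetCard.2 ⟨subset_univ _, hsized.shadow ha⟩
  have hlym := local_lubell_yamamoto_meshalkin_inequality_mul hsized
  have hchoose := Nat.choose_succ_right_eq (Fintype.card σ) d
  have e1 := card_sdiff_add_card_eq_card hA
  have e2 := card_sdiff_add_card_eq_card hsub
  rw [card_powersetCard, card_univ] at e1 e2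
  obtain ⟨q, hq⟩ := Nat.exists_eq_add_of_le (show d ≤ Fintype.card σ by omega)
  rw [hq] at hlym hchoose e1 e2
  rw [show d + q - (d + 1) + 1 = q by omega] at hlym
  rw [show d + q - d = q by omega] at hchoose
  rw [← e1, ← e2] at hchoose
  by_contra! hcon
  have h1 : 2 * d * q ≤ #((univ : Finset σ).powersetCard d \ A.shadow) * q :=
    Nat.mul_le_mul_right _ hcon
  have h2 : #((univ : Finset σ).powersetCard (d + 1) \ A) * (d + 1) ≤ (2 * d + 1) * (d + 1) :=
    Nat.mul_le_mul_right _ (by omega)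
  have h3 : d + 2 ≤ q := by omega
  nlinarith

end MonomialIdeals

/-! ### Squarefree monomial ideals of uniform families -/

namespace MonomialIdeals

open Finset MvPolynomial

variable {σ K : Type*} [Field K]

/-- The exponent vector of the squarefree monomial with support `a`. -/
noncomputable def squarefreeExponent (a : Finset σ) : σ →₀ ℕ :=
  Finsupp.indicator a fun _ _ => 1

theorem squarefreeExponent_apply [DecidableEq σ] (a : Finset σ) (i : σ) :
    squarefreeExponent a i = if i ∈ a then 1 else 0 := by
  simp [squarefreeExponent, Finsupp.indicator_apply]

theorem squarefreeExponent_le_iff [DecidableEq σ] {a b : Finset σ} :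
    squarefreeExponent a ≤ squarefreeExponent b ↔ a ⊆ b := by
  constructor
  · intro h i hi
    have := h i
    simp only [squarefreeExponent_apply, hi, if_true] at this
    by_contra hb
    simp [hb] at this
  · intro h i
    simp only [squarefreeExponent_apply]
    split_ifs with h1 h2 <;> simp_all [h _]

theorem squarefreeExponent_injective [DecidableEq σ] :
    Function.Injective (squarefreeExponent : Finset σ → σ →₀ ℕ) := fun _ _ h =>
  Subset.antisymm (squarefreeExponent_le_iff.1 h.le) (squarefreeExponent_le_iff.1 h.ge)

theorem support_squarefreeExponent [DecidableEq σ] (a : Finset σ) :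
    (squarefreeExponent a).support = a := by
  ext i
  simp [squarefreeExponent_apply]

theorem degree_squarefreeExponent [DecidableEq σ] (a : Finset σ) :
    (squarefreeExponent a).degree = #a := by
  rw [Finsupp.degree_apply, support_squarefreeExponent, card_eq_sum_ones]
  exact sum_congr rfl fun i hi => by simp [squarefreeExponent_apply, hi]

theorem squarefreeExponent_insert [DecidableEq σ] {a : Finset σ} {i : σ} (hi : i ∉ a) :
    squarefreeExponent (insert i a) = Finsupp.single i 1 + squarefreeExponent a := by
  ext j
  rcases eq_or_ne i j with rfl | hij
  · simp [squarefreeExponent_apply, hi]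
  · simp [squarefreeExponent_apply, hij.symm]

theorem squarefreeExponent_sub_single [DecidableEq σ] (a : Finset σ) (i : σ) :
    squarefreeExponent a - Finsupp.single i 1 = squarefreeExponent (a.erase i) := by
  ext j
  rcases eq_or_ne i j with rfl | hij
  · by_cases h : i ∈ a <;> simp [squarefreeExponent_apply, h]
  · simp [squarefreeExponent_apply, hij.symm]

theorem exists_squarefreeExponent_eq [DecidableEq σ] {u : σ →₀ ℕ} (hu : ∀ i, u i ≤ 1) :
    ∃ a, squarefreeExponent a = u := by
  refine ⟨u.support, ?_⟩
  ext i
  rw [squarefreeExponent_apply]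
  have := hu i
  split_ifs with h
  · have := Finsupp.mem_support_iff.1 h
    omega
  · exact (Finsupp.notMem_support_iff.1 h).symm

variable (K) in
/-- The ideal generated by the squarefree monomials whose supports belong to `A`. -/
noncomputable def familyIdeal (A : Finset (Finset σ)) : Ideal (MvPolynomial σ K) :=
  Ideal.span ((fun a => monomial (squarefreeExponent a) (1 : K)) '' (A : Set (Finset σ)))

theorem monomial_mem_familyIdeal {A : Finset (Finset σ)} {a : Finset σ} (ha : a ∈ A) :
    monomial (squarefreeExponent a) (1 : K) ∈ familyIdeal K A :=
  Ideal.subset_span ⟨a, ha, rfl⟩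

theorem familyIdeal_le_iff {A : Finset (Finset σ)} {J : Ideal (MvPolynomial σ K)} :
    familyIdeal K A ≤ J ↔ ∀ a ∈ A, monomial (squarefreeExponent a) (1 : K) ∈ J := by
  rw [familyIdeal, Ideal.span_le, Set.image_subset_iff]
  rfl

theorem mem_familyIdeal {A : Finset (Finset σ)} {f : MvPolynomial σ K} :
    f ∈ familyIdeal K A ↔ ∀ m ∈ f.support, ∃ a ∈ A, squarefreeExponent a ≤ m := by
  rw [familyIdeal, ← Set.image_image (fun u => monomial u (1 : K)) squarefreeExponent,
    mem_ideal_span_monomial_image]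
  simp

theorem monomial_mem_familyIdeal_iff {A : Finset (Finset σ)} {u : σ →₀ ℕ} :
    monomial u (1 : K) ∈ familyIdeal K A ↔ ∃ a ∈ A, squarefreeExponent a ≤ u := by
  classical
  rw [mem_familyIdeal, support_monomial, if_neg one_ne_zero]
  simp

theorem familyIdeal_empty : familyIdeal K (∅ : Finset (Finset σ)) = ⊥ := by
  simp [familyIdeal]

theorem familyIdeal_singleton (a : Finset σ) :
    familyIdeal K {a} = Ideal.span {monomial (squarefreeExponent a) (1 : K)} := by
  simp [familyIdeal]

theorem familyIdeal_union [DecidableEq σ] (A B : Finset (Finset σ)) :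
    familyIdeal K (A ∪ B) = familyIdeal K A ⊔ familyIdeal K B := by
  simp [familyIdeal, Set.image_union]

theorem familyIdeal_image_insert [DecidableEq σ] {A : Finset (Finset σ)} {i : σ}
    (hi : ∀ a ∈ A, i ∉ a) :
    familyIdeal K (A.image (insert i)) = Ideal.span {X i} * familyIdeal K A := by
  rw [familyIdeal, familyIdeal, Ideal.span_mul_span', Set.singleton_mul, coe_image,
    Set.image_image, Set.image_image]
  congr 1
  refine Set.image_congr fun a ha => ?_
  rw [squarefreeExponent_insert (hi a ha), X, monomial_mul, mul_one]

/-- A uniform family is an antichain, so none of its monomials is redundant. -/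
theorem minimalGenerators_familyIdeal [DecidableEq σ] {A : Finset (Finset σ)} {d : ℕ}
    (hA : ∀ a ∈ A, #a = d) :
    minimalGenerators (familyIdeal K A) = squarefreeExponent '' (A : Set (Finset σ)) := by
  ext u
  simp only [minimalGenerators, Set.mem_ofPred_eq, monomial_mem_familyIdeal_iff, Set.mem_image,
    mem_coe]
  constructor
  · rintro ⟨⟨a, ha, hau⟩, hmin⟩
    exact ⟨a, ha, le_antisymm hau (hmin ⟨a, ha, le_rfl⟩ hau)⟩
  · rintro ⟨a, ha, rfl⟩
    refine ⟨⟨a, ha, le_rfl⟩, ?_⟩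
    rintro v ⟨b, hb, hbv⟩ hva
    have hba := squarefreeExponent_le_iff.1 (hbv.trans hva)
    rw [← eq_of_subset_of_card_le hba (by rw [hA a ha, hA b hb])]
    exact hbv

/-- Exponents are `0` or `1`, so a derivative either vanishes or removes one variable with
coefficient `1`; the characteristic of `K` plays no role. -/
theorem gradientIdeal_familyIdeal [DecidableEq σ] {A : Finset (Finset σ)} {d : ℕ}
    (hA : ∀ a ∈ A, #a = d) :
    gradientIdeal (familyIdeal K A) = familyIdeal K A.shadow := by
  rw [gradientIdeal, minimalGenerators_familyIdeal hA]
  apply le_antisymm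
  · rw [Ideal.span_le]
    rintro f ⟨_, ⟨a, ha, rfl⟩, i, rfl⟩
    rw [SetLike.mem_coe, pderiv_monomial, squarefreeExponent_apply,
      squarefreeExponent_sub_single]
    split_ifs with hi
    · simpa using monomial_mem_familyIdeal (erase_mem_shadow ha hi)
    · simp
  · rw [familyIdeal_le_iff]
    intro b hb
    obtain ⟨a, ha, i, hi, rfl⟩ := mem_shadow_iff.1 hb
    refine Ideal.subset_span ⟨_, ⟨a, ha, rfl⟩, i, ?_⟩
    rw [pderiv_monomial, squarefreeExponent_apply, squarefreeExponent_sub_single, if_pos hi]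
    simp

/-- `x_i` is regular modulo an ideal whose generators do not involve it. This is the exactness input
for the mapping cone. -/
theorem X_mul_mem_familyIdeal_iff [DecidableEq σ] {A : Finset (Finset σ)} {i : σ}
    (hi : ∀ a ∈ A, i ∉ a) {f : MvPolynomial σ K} :
    X i * f ∈ familyIdeal K A ↔ f ∈ familyIdeal K A := by
  refine ⟨fun h => ?_, fun h => Ideal.mul_mem_left _ _ h⟩
  rw [mem_familyIdeal] at h ⊢
  intro m hm
  obtain ⟨a, ha, ham⟩ := h (Finsupp.single i 1 + m) (by
    rw [mem_support_iff, coeff_X_mul]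
    exact mem_support_iff.1 hm)
  refine ⟨a, ha, fun j => ?_⟩
  have := ham j
  rcases eq_or_ne i j with rfl | hij
  · simp [squarefreeExponent_apply, hi a ha]
  · simpa [hij] using this

theorem familyIdeal_le_familyIdeal [DecidableEq σ] {A B : Finset (Finset σ)}
    (hAB : ∀ b ∈ B, ∃ a ∈ A, a ⊆ b) : familyIdeal K B ≤ familyIdeal K A := by
  rw [familyIdeal_le_iff]
  intro b hb
  obtain ⟨a, ha, hab⟩ := hAB b hb
  exact monomial_mem_familyIdeal_iff.2 ⟨a, ha, squarefreeExponent_le_iff.2 hab⟩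

theorem VertexSplittableOn.mono [DecidableEq σ] {V W : Finset σ} {I : Ideal (MvPolynomial σ K)}
    (h : VertexSplittableOn V I) (hVW : V ⊆ W) : VertexSplittableOn W I := by
  induction h generalizing W with
  | principal V u hu => exact .principal W u (hu.trans hVW)
  | zero V => exact .zero W
  | one V => exact .one W
  | split V i hi I I₁ I₂ h₁ h₂ hI hle hunion hdisj ih₁ ih₂ =>
    exact .split W i (hVW hi) I I₁ I₂ (ih₁ hVW) (ih₂ (erase_subset_erase i hVW)) hI hle hunion
      hdisj

theorem SplittableFamily.vertexSplittableOn [DecidableEq σ] {d : ℕ} {V : Finset σ}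
    {A : Finset (Finset σ)} (h : SplittableFamily d V A) :
    VertexSplittableOn V (familyIdeal K A) := by
  induction h with
  | empty d V => rw [familyIdeal_empty]; exact .zero V
  | singleton V a ha =>
    rw [familyIdeal_singleton]
    exact .principal V _ (by rwa [support_squarefreeExponent])
  | split d V i hi A B hA hB hAB ihA ihB =>
    have hiA : ∀ a ∈ A, i ∉ a := fun a ha h =>
      hi ((mem_powersetCard.1 (hA.subset_powersetCard ha)).1 h)
    have hiB : ∀ b ∈ B, i ∉ b := fun b hb h =>
      hi ((mem_powersetCard.1 (hB.subset_powersetCard hb)).1 h)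
    have hBd : ∀ b ∈ B, #b = d + 1 := fun b hb =>
      (mem_powersetCard.1 (hB.subset_powersetCard hb)).2
    have hAd : ∀ a ∈ A.image (insert i), #a = d + 1 := by
      intro a ha
      obtain ⟨b, hb, rfl⟩ := mem_image.1 ha
      rw [card_insert_of_notMem (hiA b hb), (mem_powersetCard.1 (hA.subset_powersetCard hb)).2]
    refine .split _ i (mem_insert_self i V) _ (familyIdeal K A) (familyIdeal K B) ?_ ?_ ?_
      (familyIdeal_le_familyIdeal hAB) ?_ ?_
    · exact ihA.mono (subset_insert i V)
    · rwa [erase_insert hi]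
    · rw [familyIdeal_union, familyIdeal_image_insert hiA]
    · rw [← familyIdeal_image_insert hiA, minimalGenerators_familyIdeal hAd,
        minimalGenerators_familyIdeal hBd, minimalGenerators_familyIdeal (d := d + 1),
        coe_union, Set.image_union]
      intro a ha
      exact (mem_union.1 ha).elim (hAd a) (hBd a)
    · rw [← familyIdeal_image_insert hiA, minimalGenerators_familyIdeal hAd,
        minimalGenerators_familyIdeal hBd, Set.disjoint_image_iff squarefreeExponent_injective,
        disjoint_coe, Finset.disjoint_left]
      intro a ha hb
      obtain ⟨c, -, rfl⟩ := mem_image.1 ha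
      exact hiB _ hb (mem_insert_self _ _)

theorem minimalGenerators_subset_of_eq_span {A : Set (σ →₀ ℕ)} {u : σ →₀ ℕ}
    (hu : u ∈ minimalGenerators (Ideal.span ((fun v => monomial v (1 : K)) '' A))) : u ∈ A := by
  classical
  obtain ⟨hu1, hu2⟩ := hu
  obtain ⟨v, hv, hvu⟩ := mem_ideal_span_monomial_image.1 hu1 u (by simp [support_monomial])
  rwa [le_antisymm (hu2 (Ideal.subset_span ⟨v, hv, rfl⟩) hvu) hvu]

theorem mem_of_mem_minimalGenerators {I : Ideal (MvPolynomial σ K)} {u : σ →₀ ℕ}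
    (hu : u ∈ minimalGenerators I) : monomial u (1 : K) ∈ I :=
  Minimal.prop (P := fun v => monomial v (1 : K) ∈ I) hu

theorem exists_mem_minimalGenerators_le [Finite σ] {I : Ideal (MvPolynomial σ K)} {u : σ →₀ ℕ}
    (hu : monomial u (1 : K) ∈ I) : ∃ v ∈ minimalGenerators I, v ≤ u := by
  obtain ⟨v, hvu, hv⟩ := exists_minimal_le_of_wellFoundedLT
    (fun v => monomial v (1 : K) ∈ I) u hu
  exact ⟨v, hv, hvu⟩

/-- A squarefree monomial ideal generated in degree `d` is the ideal of a `d`-uniform family. -/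
theorem exists_familyIdeal_eq [Fintype σ] [DecidableEq σ] {I : Ideal (MvPolynomial σ K)} {d : ℕ}
    (hI : IsSquarefreeMonomialIdeal I) (hId : IsGeneratedInDegree I d) :
    ∃ A ⊆ (univ : Finset σ).powersetCard d, I = familyIdeal K A := by
  classical
  obtain ⟨B, hB, rfl⟩ := hI
  -- The generating set `B` may contain redundant monomials of other degrees, so only the minimal
  -- generators are kept.
  refine ⟨univ.filter fun a => squarefreeExponent a ∈
    minimalGenerators (Ideal.span ((fun u => monomial u (1 : K)) '' B)), ?_, ?_⟩
  · intro a ha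
    rw [mem_powersetCard, ← degree_squarefreeExponent]
    exact ⟨subset_univ _, hId _ (mem_filter.1 ha).2⟩
  · apply le_antisymm
    · rw [Ideal.span_le]
      rintro _ ⟨u, hu, rfl⟩
      obtain ⟨v, hv, hvu⟩ := exists_mem_minimalGenerators_le (Ideal.subset_span ⟨u, hu, rfl⟩ :
        monomial u (1 : K) ∈ Ideal.span ((fun u => monomial u (1 : K)) '' B))
      obtain ⟨a, rfl⟩ :=
        exists_squarefreeExponent_eq (hB v (minimalGenerators_subset_of_eq_span hv))
      exact monomial_mem_familyIdeal_iff.2 ⟨a, by simpa using hv, hvu⟩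
    · rw [familyIdeal_le_iff]
      intro a ha
      exact mem_of_mem_minimalGenerators (mem_filter.1 ha).2

theorem spanFinrank_familyIdeal_le (A : Finset (Finset σ)) :
    Submodule.spanFinrank (familyIdeal K A) ≤ #A := by
  refine (Submodule.spanFinrank_span_le_ncard_of_finite (A.finite_toSet.image _)).trans ?_
  exact (Set.ncard_image_le A.finite_toSet).trans (Set.ncard_coe_finset A).le

end MonomialIdeals

/-! ### Linear resolutions and homogeneous lifting -/

namespace MonomialIdeals

open MvPolynomial

variable {σ K : Type*} [Field K]

theorem isHomogeneous_iff_forall_degree {f : MvPolynomial σ K} {k : ℕ} :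
    f.IsHomogeneous k ↔ ∀ m ∈ f.support, m.degree = k := by
  refine ⟨fun h m hm => ?_, fun h m hm => ?_⟩
  · by_contra hne
    exact mem_support_iff.1 hm (h.coeff_eq_zero hne)
  · exact (DFunLike.congr_fun Finsupp.degree_eq_weight_one m).symm.trans
      (h m (mem_support_iff.2 hm))

theorem homogeneousComponent_mul_of_isHomogeneous {q : MvPolynomial σ K} {e : ℕ}
    (hq : q.IsHomogeneous e) (p : MvPolynomial σ K) (k : ℕ) :
    homogeneousComponent (k + e) (p * q) = homogeneousComponent k p * q := by
  induction p using MvPolynomial.induction_on' with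
  | monomial u c =>
    have hu : (monomial u c).IsHomogeneous u.degree := isHomogeneous_monomial c rfl
    rw [homogeneousComponent_of_mem hu, homogeneousComponent_of_mem (hu.mul hq)]
    by_cases h : k = u.degree <;> simp [h]
  | add p p' hp hp' => rw [add_mul, map_add, hp, hp', map_add, add_mul]

/-- A homogeneous map commutes with taking components, up to the shift `e`. Replacing a preimage by
its component therefore makes it homogeneous. -/
theorem homogeneousComponent_linearMap {ι : Type*} {e : ℕ}
    (f : (ι →₀ MvPolynomial σ K) →ₗ[MvPolynomial σ K] MvPolynomial σ K)
    (hf : ∀ b, (f (Finsupp.single b 1)).IsHomogeneous e) (v : ι →₀ MvPolynomial σ K) (k : ℕ) :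
    homogeneousComponent (k + e) (f v) =
      f (v.mapRange (homogeneousComponent k) (map_zero _)) := by
  induction v using Finsupp.induction_linear with
  | zero => simp
  | add v w hv hw =>
    rw [map_add, map_add, hv, hw, Finsupp.mapRange_add (fun _ _ => map_add _ _ _), map_add]
  | single b p =>
    have h (q : MvPolynomial σ K) : f (Finsupp.single b q) = q * f (Finsupp.single b 1) := by
      rw [← smul_eq_mul, ← map_smul, Finsupp.smul_single, smul_eq_mul, mul_one]
    rw [Finsupp.mapRange_single, h p, h (homogeneousComponent k p),
      homogeneousComponent_mul_of_isHomogeneous (hf b)]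

/-- A graded free resolution of `I` is linear if its `i`-th module is generated in degree
`D + i`. -/
def GradedFreeResolution.IsLinear {I : Ideal (MvPolynomial σ K)} (F : GradedFreeResolution I)
    (D : ℕ) : Prop :=
  ∀ i b, F.deg i b = D + i

variable (K) in
/-- A homogeneous linear map between free modules all of whose matrix entries are linear forms. -/
def HasLinearEntries {ι κ : Type*}
    (f : (ι →₀ MvPolynomial σ K) →ₗ[MvPolynomial σ K] (κ →₀ MvPolynomial σ K)) : Prop :=
  ∀ b c, (f (Finsupp.single b 1) c).IsHomogeneous 1

namespace GradedFreeResolution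

variable {I : Ideal (MvPolynomial σ K)}

theorem IsLinear.aug_isHomogeneous {F : GradedFreeResolution I} {D : ℕ} (hF : F.IsLinear D) (b) :
    (F.aug (Finsupp.single b 1)).IsHomogeneous D := by
  simpa [hF 0 b] using F.aug_homogeneous b

theorem IsLinear.hasLinearEntries_d {F : GradedFreeResolution I} {D : ℕ} (hF : F.IsLinear D)
    (i : ℕ) : HasLinearEntries K (F.d i) := by
  intro b c
  rw [isHomogeneous_iff_forall_degree]
  intro m hm
  have := F.d_homogeneous i b c m hm
  rw [hF, hF] at this
  omega

/-- The data of a graded free resolution whose `i`-th module is generated in degree `D + i`. -/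
def ofLinear (D : ℕ) (basis : ℕ → Type)
    (aug : (basis 0 →₀ MvPolynomial σ K) →ₗ[MvPolynomial σ K] MvPolynomial σ K)
    (d : ∀ i, (basis (i + 1) →₀ MvPolynomial σ K) →ₗ[MvPolynomial σ K]
      (basis i →₀ MvPolynomial σ K))
    (haug : ∀ b, (aug (Finsupp.single b 1)).IsHomogeneous D)
    (hd : ∀ i, HasLinearEntries K (d i))
    (range_aug : LinearMap.range aug = I)
    (exact_zero : LinearMap.range (d 0) = LinearMap.ker aug)
    (exact_succ : ∀ i, LinearMap.range (d (i + 1)) = LinearMap.ker (d i)) :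
    GradedFreeResolution I where
  basis := basis
  deg i _ := D + i
  aug := aug
  d := d
  aug_homogeneous := haug
  d_homogeneous i b b' m hm := by
    have := isHomogeneous_iff_forall_degree.1 (hd i b b') m hm
    omega
  range_aug := range_aug
  exact_zero := exact_zero
  exact_succ := exact_succ

end GradedFreeResolution

/-- The ideal `I` has a linear free resolution starting in degree `D`. -/
def HasLinearResolution (I : Ideal (MvPolynomial σ K)) (D : ℕ) : Prop :=
  ∃ F : GradedFreeResolution I, F.IsLinear D

theorem hasLinearResolution_bot (D : ℕ) :
    HasLinearResolution (⊥ : Ideal (MvPolynomial σ K)) D := by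
  refine ⟨.ofLinear D (fun _ => Empty) 0 (fun _ => 0) (fun b => b.elim) (fun _ b => b.elim)
    (LinearMap.range_zero) ?_ fun i => ?_, fun _ _ => rfl⟩ <;>
  exact Subsingleton.elim _ _

theorem hasLinearResolution_span_singleton {f : MvPolynomial σ K} {D : ℕ} (hf0 : f ≠ 0)
    (hf : f.IsHomogeneous D) : HasLinearResolution (Ideal.span {f}) D := by
  refine ⟨.ofLinear D (fun i => i.casesOn Unit fun _ => Empty)
    (Finsupp.linearCombination _ fun _ : Unit => f) (fun _ => 0)
    (fun b => by simpa using hf) (fun i b => b.elim) ?_ ?_ fun i => ?_, fun _ _ => rfl⟩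
  · refine (Finsupp.range_linearCombination _).trans ?_
    change Submodule.span _ (Set.range fun _ : Unit => f) = _
    rw [Set.range_const]
  · rw [LinearMap.range_zero, eq_comm, LinearMap.ker_eq_bot']
    intro (m : Unit →₀ MvPolynomial σ K) hm
    have : m = Finsupp.single () (m ()) := Finsupp.unique_ext (by simp)
    rw [this, Finsupp.linearCombination_single, smul_eq_mul, mul_eq_zero,
      or_iff_left hf0] at hm
    rw [this, hm, Finsupp.single_zero]
  · exact Subsingleton.elim (α := Submodule _ (Empty →₀ MvPolynomial σ K)) _ _

/-- Homogeneous lifting along the augmentation of a linear resolution. -/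
theorem exists_homogeneous_preimage {ι : Type*} {e k : ℕ}
    {f : (ι →₀ MvPolynomial σ K) →ₗ[MvPolynomial σ K] MvPolynomial σ K}
    (hf : ∀ b, (f (Finsupp.single b 1)).IsHomogeneous e) {g : MvPolynomial σ K}
    (hg : g.IsHomogeneous (k + e)) (hgf : g ∈ LinearMap.range f) :
    ∃ v, f v = g ∧ ∀ b, (v b).IsHomogeneous k := by
  obtain ⟨v, rfl⟩ := hgf
  refine ⟨v.mapRange (homogeneousComponent k) (map_zero _), ?_, fun b => ?_⟩
  · rw [← homogeneousComponent_linearMap f hf, homogeneousComponent_eq_self hg]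
  · exact homogeneousComponent_isHomogeneous k _

theorem HasLinearEntries.exists_homogeneous_preimage {ι κ : Type*} {k : ℕ}
    {f : (ι →₀ MvPolynomial σ K) →ₗ[MvPolynomial σ K] (κ →₀ MvPolynomial σ K)}
    (hf : HasLinearEntries K f) {g : κ →₀ MvPolynomial σ K}
    (hg : ∀ c, (g c).IsHomogeneous (k + 1)) (hgf : g ∈ LinearMap.range f) :
    ∃ v, f v = g ∧ ∀ b, (v b).IsHomogeneous k := by
  obtain ⟨v, rfl⟩ := hgf
  refine ⟨v.mapRange (homogeneousComponent k) (map_zero _), ?_, fun b => ?_⟩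
  · ext1 c
    have := homogeneousComponent_linearMap ((Finsupp.lapply c).comp f) (e := 1)
      (fun b => hf b c) v k
    simp only [LinearMap.comp_apply, Finsupp.lapply_apply] at this
    rw [← this, homogeneousComponent_eq_self (hg c)]
  · exact homogeneousComponent_isHomogeneous k _

theorem HasLinearEntries.isHomogeneous_apply {ι κ : Type*} {k : ℕ}
    {f : (ι →₀ MvPolynomial σ K) →ₗ[MvPolynomial σ K] (κ →₀ MvPolynomial σ K)}
    (hf : HasLinearEntries K f) {v : ι →₀ MvPolynomial σ K} (hv : ∀ b, (v b).IsHomogeneous k)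
    (c : κ) : (f v c).IsHomogeneous (k + 1) := by
  have := homogeneousComponent_linearMap ((Finsupp.lapply c).comp f) (e := 1)
    (fun b => hf b c) v k
  have hv' : v.mapRange (homogeneousComponent k) (map_zero _) = v := by
    ext1 b
    simp [homogeneousComponent_eq_self (hv b)]
  rw [hv'] at this
  simp only [LinearMap.comp_apply, Finsupp.lapply_apply] at this
  rw [← this]
  exact homogeneousComponent_isHomogeneous _ _

theorem exists_linearMap_of_forall_single {ι κ : Type*} {R M : Type*} [CommSemiring R]
    [AddCommMonoid M] [Module R M] {P : (κ →₀ R) → Prop}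
    (f : (κ →₀ R) →ₗ[R] M) (g : (ι →₀ R) →ₗ[R] M)
    (h : ∀ b, ∃ v, f v = g (Finsupp.single b 1) ∧ P v) :
    ∃ φ : (ι →₀ R) →ₗ[R] (κ →₀ R), f ∘ₗ φ = g ∧ ∀ b, P (φ (Finsupp.single b 1)) := by
  choose v hv hP using h
  refine ⟨Finsupp.linearCombination R v, ?_, fun b => by simpa using hP b⟩
  ext b
  simp [hv]

/-- The inclusion of ideals with linear resolutions lifts to a chain map
whose matrices consist of linear forms. -/
theorem exists_chainMap_of_le {I J : Ideal (MvPolynomial σ K)} {D : ℕ}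
    (F : GradedFreeResolution I) (hF : F.IsLinear D) (G : GradedFreeResolution J)
    (hG : G.IsLinear (D + 1)) (hJI : J ≤ I) :
    ∃ φ : ∀ i, (G.basis i →₀ MvPolynomial σ K) →ₗ[MvPolynomial σ K]
        (F.basis i →₀ MvPolynomial σ K),
      F.aug ∘ₗ φ 0 = G.aug ∧ (∀ i, F.d i ∘ₗ φ (i + 1) = φ i ∘ₗ G.d i) ∧
        ∀ i, HasLinearEntries K (φ i) := by
  -- The invariant of the recursion: `φ` is linear and carries boundaries of `G` into the range of
  -- `F.d i`, so that the next lift exists.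
  let P (i : ℕ) (φ : (G.basis i →₀ MvPolynomial σ K) →ₗ[MvPolynomial σ K]
      (F.basis i →₀ MvPolynomial σ K)) : Prop :=
    (∀ v, φ (G.d i v) ∈ LinearMap.range (F.d i)) ∧ HasLinearEntries K φ
  obtain ⟨φ₀, h₀, hlin₀⟩ := exists_linearMap_of_forall_single F.aug G.aug
    (P := fun v => ∀ b, (v b).IsHomogeneous 1) fun b => by
      refine exists_homogeneous_preimage hF.aug_isHomogeneous ?_ ?_
      · rw [add_comm]
        exact hG.aug_isHomogeneous b
      · rw [F.range_aug]
        exact hJI (G.range_aug.le (LinearMap.mem_range_self _ _))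
  have hP₀ : P 0 φ₀ := by
    refine ⟨fun v => ?_, hlin₀⟩
    rw [F.exact_zero, LinearMap.mem_ker, ← LinearMap.comp_apply, h₀, ← LinearMap.mem_ker,
      ← G.exact_zero]
    exact LinearMap.mem_range_self _ _
  have step (i : ℕ) (φ : {φ // P i φ}) :
      ∃ ψ : {ψ // P (i + 1) ψ}, F.d i ∘ₗ ψ.1 = φ.1 ∘ₗ G.d i := by
    obtain ⟨φ, hφ, hφlin⟩ := φ
    obtain ⟨ψ, hψ, hψlin⟩ := exists_linearMap_of_forall_single (F.d i) (φ ∘ₗ G.d i)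
      (P := fun v => ∀ b, (v b).IsHomogeneous 1) fun b =>
        (hF.hasLinearEntries_d i).exists_homogeneous_preimage
          (hφlin.isHomogeneous_apply (hG.hasLinearEntries_d i b)) (hφ _)
    refine ⟨⟨ψ, fun v => ?_, hψlin⟩, hψ⟩
    rw [F.exact_succ, LinearMap.mem_ker, ← LinearMap.comp_apply, hψ, LinearMap.comp_apply]
    have : G.d i (G.d (i + 1) v) = 0 := by
      rw [← LinearMap.mem_ker, ← G.exact_succ]
      exact LinearMap.mem_range_self _ _
    rw [this, map_zero]
  choose next hnext using step
  let φ (i : ℕ) : {φ // P i φ} := Nat.rec ⟨φ₀, hP₀⟩ next i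
  exact ⟨fun i => (φ i).1, h₀, fun i => hnext i (φ i), fun i => (φ i).2.2⟩

end MonomialIdeals

/-! ### The mapping cone -/

namespace MonomialIdeals

open MvPolynomial

section MappingCone

variable {R : Type*} [CommRing R]

/-- The kernel of a differential of the mapping cone, elementwise. -/
theorem cone_exact {F₂ F₁ F₀ G₂ G₁ G₀ M : Type*} [AddCommGroup F₂] [AddCommGroup F₁]
    [AddCommGroup F₀] [AddCommGroup G₂] [AddCommGroup G₁] [AddCommGroup G₀] [AddCommGroup M]
    [Module R F₂] [Module R F₁] [Module R F₀] [Module R G₂] [Module R G₁] [Module R G₀]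
    [Module R M] {f₁ : F₂ →ₗ[R] F₁} {f₀ : F₁ →ₗ[R] F₀} {g₁ : G₂ →ₗ[R] G₁} {g₀ : G₁ →ₗ[R] G₀}
    {δ : G₀ →ₗ[R] M} {φ₁ : G₁ →ₗ[R] F₁} {φ₀ : G₀ →ₗ[R] F₀} {x : R}
    (hf : LinearMap.range f₁ = LinearMap.ker f₀) (hg : LinearMap.range g₁ = LinearMap.ker g₀)
    (hδ : LinearMap.range g₀ = LinearMap.ker δ) (hφ : f₀ ∘ₗ φ₁ = φ₀ ∘ₗ g₀)
    (hx : ∀ m : M, x • m = 0 → m = 0) (a : F₁) (b : G₁) (c : G₀) :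
    (f₀ a - φ₀ c = 0 ∧ g₀ b + x • c = 0) ↔
      ∃ a' b' c', f₁ a' - φ₁ c' = a ∧ g₁ b' + x • c' = b ∧ -g₀ c' = c := by
  have hφ' (v) : f₀ (φ₁ v) = φ₀ (g₀ v) := LinearMap.congr_fun hφ v
  have hff (v) : f₀ (f₁ v) = 0 := LinearMap.mem_ker.1 (hf ▸ LinearMap.mem_range_self _ _)
  have hgg (v) : g₀ (g₁ v) = 0 := LinearMap.mem_ker.1 (hg ▸ LinearMap.mem_range_self _ _)
  have hδg (v) : δ (g₀ v) = 0 := LinearMap.mem_ker.1 (hδ ▸ LinearMap.mem_range_self _ _)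
  constructor
  -- Applying `δ` to the second equation gives `x • δ c = 0`, so `c` is a boundary. The condition
  -- `g₀ c = 0` is thus not needed as a hypothesis.
  · rintro ⟨h1, h2⟩
    obtain ⟨c', hc'⟩ : c ∈ LinearMap.range g₀ := by
      rw [hδ, LinearMap.mem_ker]
      apply hx
      simpa [hδg] using congrArg δ h2
    obtain ⟨a', ha'⟩ : a - φ₁ c' ∈ LinearMap.range f₁ := by
      rw [hf, LinearMap.mem_ker, map_sub, hφ', hc', h1]
    obtain ⟨b', hb'⟩ : b + x • c' ∈ LinearMap.range g₁ := by
      rw [hg, LinearMap.mem_ker, map_add, map_smul, hc', h2]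
    exact ⟨a', b', -c', by simp [ha'], by simp [hb'], by simp [hc']⟩
  · rintro ⟨a', b', c', rfl, rfl, rfl⟩
    simp [hff, hgg, hφ']

/-- If `x ε(a) + η(b) = 0`, then `x ε(a)` lies in the smaller ideal, hence so does `ε(a)`. This is
where `xI ∩ J = xJ` enters, and it provides the component `c'`. -/
theorem cone_exact_zero {F₁ F₀ G₁ G₀ : Type*} [AddCommGroup F₁] [AddCommGroup F₀]
    [AddCommGroup G₁] [AddCommGroup G₀] [Module R F₁] [Module R F₀] [Module R G₁] [Module R G₀]
    {f : F₁ →ₗ[R] F₀} {ε : F₀ →ₗ[R] R} {g : G₁ →ₗ[R] G₀} {η : G₀ →ₗ[R] R} {φ : G₀ →ₗ[R] F₀}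
    {x : R} (hf : LinearMap.range f = LinearMap.ker ε) (hg : LinearMap.range g = LinearMap.ker η)
    (hφ : ε ∘ₗ φ = η)
    (hx : ∀ r, x * r ∈ LinearMap.range η → r ∈ LinearMap.range η) (a : F₀) (b : G₀) :
    x • ε a + η b = 0 ↔ ∃ a' b' c', f a' - φ c' = a ∧ g b' + x • c' = b := by
  have hφ' (v) : ε (φ v) = η v := LinearMap.congr_fun hφ v
  have hff (v) : ε (f v) = 0 := LinearMap.mem_ker.1 (hf ▸ LinearMap.mem_range_self _ _)
  have hgg (v) : η (g v) = 0 := LinearMap.mem_ker.1 (hg ▸ LinearMap.mem_range_self _ _)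
  constructor
  · intro h
    obtain ⟨c', hc'⟩ := hx (ε a) ⟨-b, by rw [map_neg, ← smul_eq_mul, eq_neg_of_add_eq_zero_left h]⟩
    obtain ⟨a', ha'⟩ : a - φ c' ∈ LinearMap.range f := by
      rw [hf, LinearMap.mem_ker, map_sub, hφ', hc', sub_self]
    obtain ⟨b', hb'⟩ : b + x • c' ∈ LinearMap.range g := by
      rw [hg, LinearMap.mem_ker, map_add, map_smul, hc', add_comm, h]
    exact ⟨a', b', -c', by simp [ha'], by simp [hb']⟩
  · rintro ⟨a', b', c', rfl, rfl⟩
    simp [hff, hgg, hφ']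

theorem range_conj_eq_ker_conj {A A' B B' C C' : Type*} [AddCommGroup A] [AddCommGroup A']
    [AddCommGroup B] [AddCommGroup B'] [AddCommGroup C] [AddCommGroup C'] [Module R A]
    [Module R A'] [Module R B] [Module R B'] [Module R C] [Module R C'] (e₁ : A ≃ₗ[R] A')
    (e₂ : B ≃ₗ[R] B') (e₃ : C ≃ₗ[R] C') {f : A' →ₗ[R] B'} {g : B' →ₗ[R] C'}
    (h : LinearMap.range f = LinearMap.ker g) :
    LinearMap.range (e₂.symm.toLinearMap ∘ₗ f ∘ₗ e₁.toLinearMap) =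
      LinearMap.ker (e₃.symm.toLinearMap ∘ₗ g ∘ₗ e₂.toLinearMap) := by
  ext b
  have := SetLike.ext_iff.1 h (e₂ b)
  simp only [LinearMap.mem_range, LinearMap.mem_ker, LinearMap.comp_apply,
    LinearEquiv.coe_coe, LinearEquiv.symm_apply_eq, map_zero] at this ⊢
  rw [← this, e₁.surjective.exists]

variable (R) in
/-- Functions on an iterated disjoint union as triples of functions. -/
noncomputable def sumSumFinsuppEquiv (α β γ : Type*) :
    ((α ⊕ β) ⊕ γ →₀ R) ≃ₗ[R] ((α →₀ R) × (β →₀ R)) × (γ →₀ R) :=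
  (Finsupp.sumFinsuppLEquivProdFinsupp R).trans
    ((Finsupp.sumFinsuppLEquivProdFinsupp R).prodCongr (LinearEquiv.refl R _))

variable {α β γ : Type*}

theorem sumSumFinsuppEquiv_single_inl_inl (a : α) (r : R) :
    sumSumFinsuppEquiv R α β γ (Finsupp.single (Sum.inl (Sum.inl a)) r) =
      ((Finsupp.single a r, 0), 0) := by
  simp [sumSumFinsuppEquiv]

theorem sumSumFinsuppEquiv_single_inl_inr (b : β) (r : R) :
    sumSumFinsuppEquiv R α β γ (Finsupp.single (Sum.inl (Sum.inr b)) r) =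
      ((0, Finsupp.single b r), 0) := by
  simp [sumSumFinsuppEquiv]

theorem sumSumFinsuppEquiv_single_inr (c : γ) (r : R) :
    sumSumFinsuppEquiv R α β γ (Finsupp.single (Sum.inr c) r) = (0, Finsupp.single c r) := by
  simp [sumSumFinsuppEquiv]

theorem sumSumFinsuppEquiv_symm_apply_inl_inl (v : ((α →₀ R) × (β →₀ R)) × (γ →₀ R)) (a : α) :
    (sumSumFinsuppEquiv R α β γ).symm v (Sum.inl (Sum.inl a)) = v.1.1 a := by
  simp [sumSumFinsuppEquiv]

theorem sumSumFinsuppEquiv_symm_apply_inl_inr (v : ((α →₀ R) × (β →₀ R)) × (γ →₀ R)) (b : β) :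
    (sumSumFinsuppEquiv R α β γ).symm v (Sum.inl (Sum.inr b)) = v.1.2 b := by
  simp [sumSumFinsuppEquiv]

theorem sumSumFinsuppEquiv_symm_apply_inr (v : ((α →₀ R) × (β →₀ R)) × (γ →₀ R)) (c : γ) :
    (sumSumFinsuppEquiv R α β γ).symm v (Sum.inr c) = v.2 c := by
  simp [sumSumFinsuppEquiv]

/-- The components of the differential of the mapping cone into the two resolutions. -/
noncomputable def coneMap {F₁ F₀ G₁ G₀ : Type*} [AddCommGroup F₁] [AddCommGroup F₀]
    [AddCommGroup G₁] [AddCommGroup G₀] [Module R F₁] [Module R F₀] [Module R G₁] [Module R G₀]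
    (f : F₁ →ₗ[R] F₀) (g : G₁ →ₗ[R] G₀) (φ : G₀ →ₗ[R] F₀) (x : R) :
    (F₁ × G₁) × G₀ →ₗ[R] F₀ × G₀ :=
  (f.prodMap g).coprod ((-φ).prod (x • LinearMap.id))

theorem coneMap_apply {F₁ F₀ G₁ G₀ : Type*} [AddCommGroup F₁] [AddCommGroup F₀]
    [AddCommGroup G₁] [AddCommGroup G₀] [Module R F₁] [Module R F₀] [Module R G₁] [Module R G₀]
    (f : F₁ →ₗ[R] F₀) (g : G₁ →ₗ[R] G₀) (φ : G₀ →ₗ[R] F₀) (x : R) (v : (F₁ × G₁) × G₀) :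
    coneMap f g φ x v = (f v.1.1 - φ v.2, g v.1.2 + x • v.2) := by
  simp [coneMap, sub_eq_add_neg]

/-- The bases of the mapping cone of a chain map. -/
def coneBasis (F G : ℕ → Type) : ℕ → Type
  | 0 => F 0 ⊕ G 0
  | i + 1 => (F (i + 1) ⊕ G (i + 1)) ⊕ G i

/-- The differentials of the mapping cone of the chain map `(φ, -x)`. -/
noncomputable def coneDifferential {F G : ℕ → Type} (f : ∀ i, (F (i + 1) →₀ R) →ₗ[R] (F i →₀ R))
    (g : ∀ i, (G (i + 1) →₀ R) →ₗ[R] (G i →₀ R)) (φ : ∀ i, (G i →₀ R) →ₗ[R] (F i →₀ R)) (x : R) :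
    ∀ i, (coneBasis F G (i + 1) →₀ R) →ₗ[R] (coneBasis F G i →₀ R)
  | 0 => (Finsupp.sumFinsuppLEquivProdFinsupp R).symm.toLinearMap ∘ₗ coneMap (f 0) (g 0) (φ 0) x ∘ₗ
      (sumSumFinsuppEquiv R (F 1) (G 1) (G 0)).toLinearMap
  | i + 1 => (sumSumFinsuppEquiv R (F (i + 1)) (G (i + 1)) (G i)).symm.toLinearMap ∘ₗ
      (coneMap (f (i + 1)) (g (i + 1)) (φ (i + 1)) x).prod (-g i ∘ₗ LinearMap.snd _ _ _) ∘ₗ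
      (sumSumFinsuppEquiv R (F (i + 2)) (G (i + 2)) (G (i + 1))).toLinearMap

end MappingCone

variable {σ K : Type*} [Field K]

theorem isHomogeneous_single {ι : Type*} {x : MvPolynomial σ K} {k : ℕ} (hx : x.IsHomogeneous k)
    (b c : ι) : (Finsupp.single b x c).IsHomogeneous k := by
  classical
  rw [Finsupp.single_apply]
  split_ifs
  · exact hx
  · exact isHomogeneous_zero _ _ _

section LinearEntries

variable {F₁ F₀ G₁ G₀ G' : Type*}
  {f : (F₁ →₀ MvPolynomial σ K) →ₗ[MvPolynomial σ K] (F₀ →₀ MvPolynomial σ K)}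
  {g : (G₁ →₀ MvPolynomial σ K) →ₗ[MvPolynomial σ K] (G₀ →₀ MvPolynomial σ K)}
  {g' : (G₀ →₀ MvPolynomial σ K) →ₗ[MvPolynomial σ K] (G' →₀ MvPolynomial σ K)}
  {φ : (G₀ →₀ MvPolynomial σ K) →ₗ[MvPolynomial σ K] (F₀ →₀ MvPolynomial σ K)}
  {x : MvPolynomial σ K}

theorem HasLinearEntries.conj_coneMap (hf : HasLinearEntries K f) (hg : HasLinearEntries K g)
    (hφ : HasLinearEntries K φ) (hx : x.IsHomogeneous 1) :
    HasLinearEntries K ((Finsupp.sumFinsuppLEquivProdFinsupp _).symm.toLinearMap ∘ₗ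
      coneMap f g φ x ∘ₗ (sumSumFinsuppEquiv _ F₁ G₁ G₀).toLinearMap) := by
  have h0 : (0 : MvPolynomial σ K).IsHomogeneous 1 := isHomogeneous_zero _ _ _
  rintro ((b | b) | b) (c | c) <;>
  simp [coneMap_apply, sumSumFinsuppEquiv_single_inl_inl, sumSumFinsuppEquiv_single_inl_inr,
    sumSumFinsuppEquiv_single_inr, h0, hf _ _, hg _ _, (hφ _ _).neg, isHomogeneous_single hx]

theorem HasLinearEntries.conj_coneMap_prod (hf : HasLinearEntries K f)
    (hg : HasLinearEntries K g) (hg' : HasLinearEntries K g') (hφ : HasLinearEntries K φ)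
    (hx : x.IsHomogeneous 1) :
    HasLinearEntries K ((sumSumFinsuppEquiv _ F₀ G₀ G').symm.toLinearMap ∘ₗ
      (coneMap f g φ x).prod (-g' ∘ₗ LinearMap.snd _ _ _) ∘ₗ
      (sumSumFinsuppEquiv _ F₁ G₁ G₀).toLinearMap) := by
  have h0 : (0 : MvPolynomial σ K).IsHomogeneous 1 := isHomogeneous_zero _ _ _
  rintro ((b | b) | b) ((c | c) | c) <;>
  simp [coneMap_apply, sumSumFinsuppEquiv_single_inl_inl, sumSumFinsuppEquiv_single_inl_inr,
    sumSumFinsuppEquiv_single_inr, sumSumFinsuppEquiv_symm_apply_inl_inl,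
    sumSumFinsuppEquiv_symm_apply_inl_inr, sumSumFinsuppEquiv_symm_apply_inr, h0, hf _ _, hg _ _,
    (hφ _ _).neg, (hg' _ _).neg, isHomogeneous_single hx]

end LinearEntries

/-- If multiplication by the linear form `x` is injective modulo `J ≤ I`, then the mapping cone of
the inclusion is a linear resolution of `x I + J`. -/
theorem HasLinearResolution.span_mul_sup {I J : Ideal (MvPolynomial σ K)} {D : ℕ}
    (hI : HasLinearResolution I D) (hJ : HasLinearResolution J (D + 1)) (hJI : J ≤ I)
    {x : MvPolynomial σ K} (hx0 : x ≠ 0) (hx : x.IsHomogeneous 1)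
    (hxJ : ∀ f, x * f ∈ J → f ∈ J) :
    HasLinearResolution (Ideal.span {x} * I ⊔ J) (D + 1) := by
  obtain ⟨F, hF⟩ := hI
  obtain ⟨G, hG⟩ := hJ
  obtain ⟨φ, hφ₀, hφ, hφlin⟩ := exists_chainMap_of_le F hF G hG hJI
  let e₀ := Finsupp.sumFinsuppLEquivProdFinsupp (α := F.basis 0) (β := G.basis 0)
    (M := MvPolynomial σ K) (MvPolynomial σ K)
  let e (i : ℕ) := sumSumFinsuppEquiv (MvPolynomial σ K) (F.basis (i + 1)) (G.basis (i + 1))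
    (G.basis i)
  let aug := ((x • F.aug).coprod G.aug) ∘ₗ e₀.toLinearMap
  let D' (i : ℕ) := (coneMap (F.d (i + 1)) (G.d (i + 1)) (φ (i + 1)) x).prod
    (-G.d i ∘ₗ LinearMap.snd _ _ _)
  have hxr : ∀ r, x * r ∈ LinearMap.range G.aug → r ∈ LinearMap.range G.aug := by
    rwa [G.range_aug]
  -- The last component of the cone differential vanishes automatically: applying `G.d i` to `G.d (i
  -- + 1) b + x • c = 0` leaves `x • G.d i c = 0`. This matches the two conditions in `cone_exact`.
  have hD : ∀ i v, D' i v = 0 ↔ coneMap (F.d (i + 1)) (G.d (i + 1)) (φ (i + 1)) x v = 0 := by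
    intro i v
    refine ⟨fun h => congrArg Prod.fst h, fun h => Prod.ext h ?_⟩
    have h1 := congrArg (G.d i) (congrArg Prod.snd h)
    have h2 : G.d i (G.d (i + 1) v.1.2) = 0 :=
      LinearMap.mem_ker.1 (G.exact_succ i ▸ LinearMap.mem_range_self _ _)
    simp only [coneMap_apply, map_add, h2, map_smul, zero_add, Prod.snd_zero, map_zero] at h1
    simp [D', (smul_eq_zero.1 h1).resolve_left hx0]
  have haug : ∀ b, (aug (Finsupp.single b 1)).IsHomogeneous (D + 1) := by
    rintro (b | b)
    · simpa [aug, e₀, add_comm] using hx.mul (hF.aug_isHomogeneous b)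
    · simpa [aug, e₀] using hG.aug_isHomogeneous b
  have hrange : LinearMap.range aug = Ideal.span {x} * I ⊔ J := by
    rw [LinearMap.range_comp, LinearEquiv.range, Submodule.map_top, LinearMap.range_coprod,
      G.range_aug]
    congr 1
    have hmem (z) : z ∈ I ↔ ∃ v, F.aug v = z := (SetLike.ext_iff.1 F.range_aug z).symm
    ext f
    simp [Ideal.mem_span_singleton_mul, hmem]
  refine ⟨.ofLinear (D + 1) (coneBasis F.basis G.basis) aug
    (coneDifferential F.d G.d φ x) haug ?_ hrange ?_ ?_, fun _ _ => rfl⟩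
  · have hdF := hF.hasLinearEntries_d
    have hdG := hG.hasLinearEntries_d
    rintro (_ | i)
    · exact (hdF 0).conj_coneMap (hdG 0) (hφlin 0) hx
    · exact (hdF (i + 1)).conj_coneMap_prod (hdG (i + 1)) (hdG i) (hφlin (i + 1)) hx
  · refine range_conj_eq_ker_conj (e 0) e₀ (LinearEquiv.refl _ _)
      (g := (x • F.aug).coprod G.aug) ?_
    ext ⟨a, b⟩
    have := cone_exact_zero F.exact_zero G.exact_zero hφ₀ hxr a b
    simp only [smul_eq_mul] at this
    simp [coneMap_apply, this]
  · rintro (_ | i)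
    · refine range_conj_eq_ker_conj (e 1) (e 0) e₀ ?_
      ext ⟨⟨a, b⟩, c⟩
      have := cone_exact (F.exact_succ 0) (G.exact_succ 0) G.exact_zero (hφ 0)
        (fun m h => (smul_eq_zero.1 h).resolve_left hx0) a b c
      simp [coneMap_apply, this, and_assoc]
    · refine range_conj_eq_ker_conj (e (i + 2)) (e (i + 1)) (e i) ?_
      ext ⟨⟨a, b⟩, c⟩
      have := cone_exact (F.exact_succ (i + 1)) (G.exact_succ (i + 1)) (G.exact_succ i)
        (hφ (i + 1)) (fun m h => (smul_eq_zero.1 h).resolve_left hx0) a b c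
      rw [LinearMap.mem_ker]
      refine Iff.trans ?_ (hD i _).symm
      simp [coneMap_apply, this, and_assoc]

/-- Since `F i` lives in degree `D + i`, only `j - i = D` can occur. It does occur at `i = 0`: no
basis element of `F 1` has degree `D`, so generators of `F 0` are not boundaries. -/
theorem HasLinearResolution.hasRegularity {I : Ideal (MvPolynomial σ K)} {D : ℕ}
    (h : HasLinearResolution I D) (hI : I ≠ ⊥) : HasRegularity I D := by
  obtain ⟨F, hF⟩ := h
  refine ⟨F, ?_, ?_⟩
  · obtain ⟨b⟩ : Nonempty (F.basis 0) := by
      by_contra hne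
      rw [not_nonempty_iff] at hne
      apply hI
      rw [← F.range_aug, Subsingleton.elim F.aug 0, LinearMap.range_zero]
    refine ⟨0, D, ⟨Finsupp.single b 1, ⟨Submodule.mem_top, ?_⟩, ?_⟩, by simp⟩
    · exact Finsupp.single_mem_supported K 1 (hF 0 b)
    · have : F.degreePart 1 D = ⊥ := by
        rw [GradedFreeResolution.degreePart, show {b | F.deg 1 b = D} = ∅ from ?_,
          Finsupp.supported_empty]
        ext b
        simp [hF 1 b]
      simp [GradedFreeResolution.boundaries, this]
  · rintro _ ⟨i, j, ⟨z, ⟨-, hz⟩, hzb⟩, rfl⟩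
    have hz0 : z ≠ 0 := by
      rintro rfl
      exact hzb (Submodule.zero_mem _)
    obtain ⟨b, hb⟩ := Finsupp.support_nonempty_iff.2 hz0
    have hbj : F.deg i b = j := (Finsupp.mem_supported K z).1 hz hb
    rw [hF] at hbj
    omega

end MonomialIdeals

/-! ### Iterated gradients and conclusion -/

namespace MonomialIdeals

open Finset MvPolynomial

variable {σ K : Type*} [Field K]

theorem SplittableFamily.hasLinearResolution [DecidableEq σ] {d : ℕ} {V : Finset σ}
    {A : Finset (Finset σ)} (h : SplittableFamily d V A) :
    HasLinearResolution (familyIdeal K A) d := by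
  induction h with
  | empty d V => rw [familyIdeal_empty]; exact hasLinearResolution_bot d
  | singleton V a ha =>
    rw [familyIdeal_singleton]
    exact hasLinearResolution_span_singleton (by simp)
      (isHomogeneous_monomial 1 (degree_squarefreeExponent a))
  | split d V i hi A B hA hB hAB ihA ihB =>
    have hiA : ∀ a ∈ A, i ∉ a := fun a ha h =>
      hi ((mem_powersetCard.1 (hA.subset_powersetCard ha)).1 h)
    have hiB : ∀ b ∈ B, i ∉ b := fun b hb h =>
      hi ((mem_powersetCard.1 (hB.subset_powersetCard hb)).1 h)
    rw [familyIdeal_union, familyIdeal_image_insert hiA]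
    exact ihA.span_mul_sup ihB (familyIdeal_le_familyIdeal hAB) (X_ne_zero i)
      (isHomogeneous_X K i) fun f => (X_mul_mem_familyIdeal_iff hiB).1

theorem familyIdeal_ne_bot {A : Finset (Finset σ)} (hA : A.Nonempty) : familyIdeal K A ≠ ⊥ := by
  obtain ⟨a, ha⟩ := hA
  intro h
  have := monomial_mem_familyIdeal (K := K) ha
  rw [h, Ideal.mem_bot, monomial_eq_zero] at this
  exact one_ne_zero this

/-- A nonempty uniform family with few missing members stays so under iterated shadows. -/
theorem gradientIdeal_iterate_familyIdeal [Fintype σ] [DecidableEq σ] {d : ℕ}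
    {A : Finset (Finset σ)} (hA : A ⊆ (univ : Finset σ).powersetCard d) (hne : A.Nonempty)
    (hn : 2 * d ≤ Fintype.card σ)
    (h : d ≤ 1 ∨ #((univ : Finset σ).powersetCard d \ A) < 2 * d) (ℓ : ℕ) (hℓ : ℓ ≤ d) :
    ∃ B, B.Nonempty ∧ SplittableFamily (d - ℓ) univ B ∧
      gradientIdeal^[ℓ] (familyIdeal K A) = familyIdeal K B := by
  induction ℓ generalizing d A with
  | zero =>
    exact ⟨A, hne, splittableFamily_of_card hA (h.imp_right Or.inr), rfl⟩
  | succ ℓ ih =>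
    obtain ⟨e, rfl⟩ : ∃ e, d = e + 1 := ⟨d - 1, by omega⟩
    have hsized : (A : Set (Finset σ)).Sized (e + 1) := fun a ha =>
      (mem_powersetCard.1 (hA ha)).2
    rw [Function.iterate_succ_apply, gradientIdeal_familyIdeal hsized, Nat.add_sub_add_right]
    refine ih (fun a ha => mem_powersetCard.2 ⟨subset_univ _, hsized.shadow ha⟩) ?_
      (by omega) ?_ (by omega)
    · obtain ⟨a, ha⟩ := hne
      obtain ⟨i, hi⟩ : a.Nonempty := card_pos.1 (by rw [hsized ha]; omega)
      exact ⟨_, erase_mem_shadow ha hi⟩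
    -- The bound `< 2e` is impossible for `e = 0`, and the LYM estimate is not strict enough for `e
    -- = 1`; uniformity at most one needs no bound.
    · rcases le_or_gt e 1 with he | he
      · exact Or.inl he
      · exact Or.inr (card_compl_shadow_lt hA he hn (h.resolve_left (by omega)))

/-- `2d = C(2d, 1) ≤ C(2d, d) ≤ C(n, d)`. This makes the assumed number of generators positive, so
the ideal is nonzero and has a regularity. -/
theorem two_mul_le_choose {n d : ℕ} (hn : 2 * d ≤ n) : 2 * d ≤ n.choose d := by
  have h1 := (Nat.choose_le_centralBinom 1 d).trans (Nat.choose_le_choose d hn)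
  rwa [Nat.choose_one_right] at h1

end MonomialIdeals

theorem theorem4p1 {K : Type*} [Field K] (n d : ℕ) (I : Ideal (MvPolynomial (Fin n) K))
    (hI : MonomialIdeals.IsSquarefreeMonomialIdeal I)
    (hId : MonomialIdeals.IsGeneratedInDegree I d)
    (hμ : (n.choose d : ℤ) - 2 * (d : ℤ) + 1 ≤ (Submodule.spanFinrank I : ℤ))
    (hn : 2 * d ≤ n) :
    ∀ ℓ : ℕ, ℓ ≤ d →
      MonomialIdeals.IsVertexSplittable (MonomialIdeals.gradientIdeal^[ℓ] I) ∧
      MonomialIdeals.HasRegularity (MonomialIdeals.gradientIdeal^[ℓ] I) ((d : ℤ) - (ℓ : ℤ)) := by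
  intro ℓ hℓ
  obtain ⟨A, hA, rfl⟩ := MonomialIdeals.exists_familyIdeal_eq hI hId
  have hle := MonomialIdeals.spanFinrank_familyIdeal_le (K := K) A
  have hcard := Finset.card_sdiff_add_card_eq_card hA
  rw [Finset.card_powersetCard, Finset.card_univ, Fintype.card_fin] at hcard
  have hne : A.Nonempty := by
    rw [← Finset.card_pos]
    have := MonomialIdeals.two_mul_le_choose hn
    omega
  obtain ⟨B, hBne, hB, hBI⟩ := MonomialIdeals.gradientIdeal_iterate_familyIdeal (K := K) hA hne
    (by simpa using hn) (Or.inr (by omega)) ℓ hℓ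
  rw [hBI, ← Nat.cast_sub hℓ]
  exact ⟨hB.vertexSplittableOn,
    hB.hasLinearResolution.hasRegularity (MonomialIdeals.familyIdeal_ne_bot hBne)⟩
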